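/- Let $\mathcal H,\mathcal K$ be (real or complex, not necessarily separable) Hilbert spaces, $\mathcal M,\mathcal N\subseteq\mathcal H$ closed subspaces, and $A,B\in\mathcal B(\mathcal H,\mathcal K)$ bounded operators that coincide on $\mathcal M\cap\mathcal N$. Let $C_{\mathcal M,\mathcal N}(A,B)$ be the linear operator with domain $\mathcal M+\mathcal N$ that coincides with $A$ on $\mathcal M$ and with $B$ on $\mathcal N$; it is called bounded if it is bounded with respect to the norm of $\mathcal H$ on $\mathcal M+\mathcal N$. Let $\mathcal M_0$ be the orthogonal complement of $(\mathcal M\cap\mathcal N)\oplus(\mathcal M\cap\mathcal N^\perp)$ in $\mathcal M$, and $\mathcal M_1$ the orthogonal complement of $(\mathcal M^\perp\cap\mathcal N)\oplus(\mathcal M^\perp\cap\mathcal N^\perp)$ in $\mathcal M^\perp$. (a) If $\mathcal M_0=\{0\}$, then $C_{\mathcal M,\mathcal N}(A,B)$ is bounded. (b) Suppose $\mathcal M_0\neq\{0\}$. Then (Halmos) there are a unitary operator $R:\mathcal M_0\to\mathcal M_1$ and a positive contraction $S\in\mathcal B(\mathcal M_0)$, with $S$ and $1-S$ injective, such that the orthogonal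 projection $P_{\mathcal N}$ onto $\mathcal N$ satisfies $$P_{\mathcal N}|_{\mathcal M_0\oplus\mathcal M_1}=\begin{bmatrix}1-S^2 & S\sqrt{1-S^2}\,R^*\\ RS\sqrt{1-S^2} & RS^2R^*\end{bmatrix}.$$ Let $D:\mathcal M_0\to\mathcal K$ be the restriction of $A-B$ to $\mathcal M_0$. For every such pair $(R,S)$, the operator $C_{\mathcal M,\mathcal N}(A,B)$ is bounded if and only if $\mathcal R(D^*)\subseteq\mathcal R(S)$, where $\mathcal R$ denotes the range. -/

import Mathlib

noncomputable section

namespace TwoSubspaces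

variable {𝕜 H K : Type*} [RCLike 𝕜]
  [NormedAddCommGroup H] [InnerProductSpace 𝕜 H]
  [NormedAddCommGroup K] [InnerProductSpace 𝕜 K]

/-- The operator `C_{M,N}(A,B)`: its domain is `M + N`, it coincides with `A` on `M` and with `B`
on `N`. It is defined when `A` and `B` coincide on `M ∩ N`. -/
def simExt (M N : Submodule 𝕜 H) (A B : H →L[𝕜] K) (hAB : ∀ x ∈ M ⊓ N, A x = B x) :
    H →ₗ.[𝕜] K :=
  ((A : H →ₗ[𝕜] K).toPMap M).sup ((B : H →ₗ[𝕜] K).toPMap N) (by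
    rintro ⟨x, hx⟩ ⟨y, hy⟩ hxy
    obtain rfl : x = y := hxy
    exact hAB x ⟨hx, hy⟩)

/-- A partially defined linear operator is bounded, its domain carrying the norm of the ambient
space. -/
def IsBoundedOp (T : H →ₗ.[𝕜] K) : Prop :=
  ∃ c : ℝ, ∀ x : T.domain, ‖T x‖ ≤ c * ‖(x : H)‖

/-- The orthogonal complement in `M` of `(M ∩ N) ⊕ (M ∩ Nᗮ)`. Thus `genericPart M N` is the
subspace `M₀` and `genericPart Mᗮ N` is the subspace `M₁` of Halmos' decomposition. -/
def genericPart (M N : Submodule 𝕜 H) : Submodule 𝕜 H :=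
  M ⊓ ((M ⊓ N) ⊔ (M ⊓ Nᗮ))ᗮ

instance isClosed_genericPart (M N : Submodule 𝕜 H) [hM : IsClosed (M : Set H)] :
    IsClosed (genericPart M N : Set H) :=
  hM.inter (Submodule.isClosed_orthogonal _)

/-- `T` is the (unique) positive square root of `X`. -/
def IsPosSqrt (T X : H →L[𝕜] H) : Prop :=
  T.IsPositive ∧ T * T = X

/-- `R` and `S` are the operators of Halmos' two projections theorem for the pair `M`, `N`:
`R : M₀ → M₁` is unitary, `S` is a positive contraction on `M₀` such that `S` and `1 - S` are
injective, and, with respect to `M₀ ⊕ M₁`, the orthogonal projection onto `N` has the matrix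
`[[1 - S², S √(1 - S²) R*], [R S √(1 - S²), R S² R*]]`. The adjoint of the unitary `R` is its
inverse `R.symm`. -/
structure IsHalmosPair [CompleteSpace H] (M N : Submodule 𝕜 H) [IsClosed (N : Set H)]
    (R : genericPart M N ≃ₗᵢ[𝕜] genericPart Mᗮ N)
    (S : genericPart M N →L[𝕜] genericPart M N) : Prop where
  isPositive : S.IsPositive
  norm_le_one : ‖S‖ ≤ 1
  injective : Function.Injective S
  injective_one_sub : Function.Injective (1 - S : genericPart M N →L[𝕜] genericPart M N)
  matrix : ∃ T : genericPart M N →L[𝕜] genericPart M N, IsPosSqrt T (1 - S * S) ∧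
    ∀ (x : genericPart M N) (y : genericPart Mᗮ N),
      N.starProjection ((x : H) + (y : H)) =
        (((1 - S * S) x + (S * T) (R.symm y) : genericPart M N) : H) +
        ((R ((S * T) x) + R ((S * S) (R.symm y)) : genericPart Mᗮ N) : H)

/-- The operator `D : M₀ → K`, the restriction of `A - B` to `M₀`. -/
def diffRestrict (M N : Submodule 𝕜 H) (A B : H →L[𝕜] K) : genericPart M N →L[𝕜] K :=
  (A - B) ∘L (genericPart M N).subtypeL

end TwoSubspaces

end

/-! Write `C(m + n) = (A - B) m + B (m + n)`. For fixed `m`, the least norm of `m + n` over `n ∈ N`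
is `‖m - P_N m‖`, so `C` is bounded iff `‖(A - B) m‖ ≤ c ‖m - P_N m‖` on `M`
(`isBoundedOp_simExt_iff`). Both sides vanish on `M ∩ N`, and the estimate is automatic on `M ∩ Nᗮ`;
only `M₀` matters, which settles (a).

On `M₀` the upper left entry `1 - S²` of the matrix gives `‖x - P_N x‖ = ‖S x‖`. The condition
becomes `‖D x‖ ≤ c ‖S x‖`, and the Douglas lemma turns it into the range inclusion.

For the existence of `(R, S)`, let `X` and `Q` be the blocks of `P_N` from `M₀` to `M₀` and `M₁`.
Put `S = √(1 - X)` and `T = √X`. Idempotence gives `Q*Q = X - X² = (ST)²`, so `STx ↦ Qx` is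
isometric between dense ranges and extends to `R`. -/

namespace TwoSubspaces

open Filter Topology ContinuousLinearMap

/-! ### Square roots, the Douglas lemma and Halmos' theorem in matrix form. -/

section Operators

variable {𝕜 E F : Type*} [RCLike 𝕜]
  [NormedAddCommGroup E] [InnerProductSpace 𝕜 E]
  [NormedAddCommGroup F] [InnerProductSpace 𝕜 F]

/-- The iteration `w ↦ (y + w²) / 2`, started at `0`, whose limit `w` satisfies
`(1 - w)² = 1 - y`. -/
noncomputable def sqrtIter {𝔸 : Type*} [Ring 𝔸] (𝕜 : Type*) [DivisionRing 𝕜] [Module 𝕜 𝔸]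
    (y : 𝔸) : ℕ → 𝔸
  | 0 => 0
  | n + 1 => (2⁻¹ : 𝕜) • (y + sqrtIter 𝕜 y n * sqrtIter 𝕜 y n)

lemma sqrtIter_one_le_one (n : ℕ) : 0 ≤ sqrtIter ℝ (1 : ℝ) n ∧ sqrtIter ℝ (1 : ℝ) n ≤ 1 := by
  induction n with
  | zero => simp [sqrtIter]
  | succ n ih => simp only [sqrtIter, smul_eq_mul]; constructor <;> nlinarith

lemma sqrtIter_one_le_succ (n : ℕ) : sqrtIter ℝ (1 : ℝ) n ≤ sqrtIter ℝ (1 : ℝ) (n + 1) := by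
  simp only [sqrtIter, smul_eq_mul]
  nlinarith [sq_nonneg (1 - sqrtIter ℝ (1 : ℝ) n)]

lemma commute_sqrtIter {y z : E →L[𝕜] E} (h : Commute y z) (n : ℕ) :
    Commute (sqrtIter 𝕜 y n) z := by
  induction n with
  | zero => exact Commute.zero_left z
  | succ n ih => exact (h.add_left (ih.mul_left ih)).smul_left _

/-- The recursion has nonnegative coefficients, so the scalar iteration for `y = 1` is a majorant.
-/
lemma norm_sqrtIter_le {y : E →L[𝕜] E} (h : ‖y‖ ≤ 1) (n : ℕ) :
    ‖sqrtIter 𝕜 y n‖ ≤ sqrtIter ℝ (1 : ℝ) n := by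
  induction n with
  | zero => simp [sqrtIter]
  | succ n ih =>
    simp only [sqrtIter, smul_eq_mul]
    rw [norm_smul]
    have h1 : ‖(2⁻¹ : 𝕜)‖ = 2⁻¹ := by simp
    rw [h1]
    gcongr
    exact (norm_add_le _ _).trans (add_le_add h
      ((norm_mul_le _ _).trans (mul_le_mul ih ih (norm_nonneg _) (sqrtIter_one_le_one n).1)))

/-- Iterates commute, so the difference of their squares factors and the majorant passes to
increments. The scalar increments telescope, which yields a Cauchy sequence. -/
lemma norm_sqrtIter_succ_sub_le {y : E →L[𝕜] E} (h : ‖y‖ ≤ 1) (n : ℕ) :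
    ‖sqrtIter 𝕜 y (n + 1) - sqrtIter 𝕜 y n‖ ≤
      sqrtIter ℝ (1 : ℝ) (n + 1) - sqrtIter ℝ (1 : ℝ) n := by
  induction n with
  | zero =>
    have h0 := norm_sqrtIter_le (𝕜 := 𝕜) h 1
    simpa only [sqrtIter.eq_1, sub_zero] using h0
  | succ n ih =>
    have hc : Commute (sqrtIter 𝕜 y (n + 1)) (sqrtIter 𝕜 y n) :=
      commute_sqrtIter (commute_sqrtIter (Commute.refl y) n).symm (n + 1)
    have e : sqrtIter 𝕜 y (n + 2) - sqrtIter 𝕜 y (n + 1) = (2⁻¹ : 𝕜) •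
        ((sqrtIter 𝕜 y (n + 1) + sqrtIter 𝕜 y n) * (sqrtIter 𝕜 y (n + 1) - sqrtIter 𝕜 y n)) := by
      rw [← hc.mul_self_sub_mul_self_eq,
        ← add_sub_add_left_eq_sub (_ * _) (sqrtIter 𝕜 y n * _) y, smul_sub]
      rfl
    have e' : sqrtIter ℝ (1 : ℝ) (n + 2) - sqrtIter ℝ (1 : ℝ) (n + 1) = 2⁻¹ *
        ((sqrtIter ℝ (1 : ℝ) (n + 1) + sqrtIter ℝ (1 : ℝ) n) *
          (sqrtIter ℝ (1 : ℝ) (n + 1) - sqrtIter ℝ (1 : ℝ) n)) := by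
      rw [sqrtIter.eq_2 ℝ (1 : ℝ) (n + 1)]
      simp only [sqrtIter.eq_2 ℝ (1 : ℝ) n, smul_eq_mul]
      ring
    have h2 : ‖(2⁻¹ : 𝕜)‖ = 2⁻¹ := by simp
    rw [e, e', norm_smul, h2]
    gcongr
    refine (norm_mul_le _ _).trans (mul_le_mul ?_ ih (norm_nonneg _)
      (add_nonneg (sqrtIter_one_le_one _).1 (sqrtIter_one_le_one _).1))
    exact (norm_add_le _ _).trans (add_le_add (norm_sqrtIter_le h _) (norm_sqrtIter_le h _))

variable [CompleteSpace E] [CompleteSpace F]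

lemma isSelfAdjoint_sqrtIter {y : E →L[𝕜] E} (h : IsSelfAdjoint y) (n : ℕ) :
    IsSelfAdjoint (sqrtIter 𝕜 y n) := by
  induction n with
  | zero => exact IsSelfAdjoint.zero _
  | succ n ih =>
    refine IsSelfAdjoint.smul (by simp [IsSelfAdjoint]) (h.add ?_)
    simpa [ih.star_eq] using IsSelfAdjoint.mul_star_self (sqrtIter 𝕜 y n)

/-- A self-adjoint contraction `y` gives rise to a positive square root of `1 - y`, which commutes
with every operator that commutes with `y`. -/
theorem exists_isPosSqrt_one_sub {y : E →L[𝕜] E} (hy : IsSelfAdjoint y) (h : ‖y‖ ≤ 1) :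
    ∃ T : E →L[𝕜] E, IsPosSqrt T (1 - y) ∧ ∀ z, Commute y z → Commute T z := by
  have hcau : CauchySeq (sqrtIter 𝕜 y) := by
    have hw : Summable fun n => sqrtIter ℝ (1 : ℝ) (n + 1) - sqrtIter ℝ (1 : ℝ) n := by
      refine summable_of_sum_range_le (c := 1)
        (fun n => sub_nonneg.2 (sqrtIter_one_le_succ n)) fun n => ?_
      rw [Finset.sum_range_sub]
      simpa [sqrtIter] using (sqrtIter_one_le_one n).2
    refine cauchySeq_of_dist_le_of_summable _ (fun n => ?_) hw
    rw [dist_comm, dist_eq_norm]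
    exact norm_sqrtIter_succ_sub_le h n
  obtain ⟨w, hw⟩ := cauchySeq_tendsto_of_complete hcau
  have hfix : w = (2⁻¹ : 𝕜) • (y + w * w) :=
    tendsto_nhds_unique ((tendsto_add_atTop_iff_nat 1).2 hw)
      (((tendsto_const_nhds.add (hw.mul hw)).const_smul _))
  have hsa : IsSelfAdjoint w :=
    (isClosed_eq continuous_star continuous_id).mem_of_tendsto hw
      (Eventually.of_forall fun n => isSelfAdjoint_sqrtIter hy n)
  have hn : ‖w‖ ≤ 1 := le_of_tendsto hw.norm
    (Eventually.of_forall fun n => (norm_sqrtIter_le h n).trans (sqrtIter_one_le_one n).2)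
  have hfix2 : w + w = y + w * w := by
    conv_lhs => rw [hfix]
    rw [← smul_add, ← two_smul 𝕜, smul_smul]
    norm_num
  refine ⟨1 - w, ⟨⟨?_, fun x => ?_⟩, ?_⟩, fun z hz => ?_⟩
  · exact isSelfAdjoint_iff_isSymmetric.1 ((IsSelfAdjoint.one _).sub hsa)
  · have h1 : RCLike.re (inner 𝕜 (w x) x) ≤ ‖x‖ * ‖x‖ := by
      refine (re_inner_le_norm _ _).trans ?_
      gcongr
      simpa using w.le_of_opNorm_le hn x
    simpa [reApplyInnerSelf, inner_sub_left, sq] using h1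
  · have : (1 - w) * (1 - w) = 1 - (w + w) + w * w := by noncomm_ring
    rw [this, hfix2]
    abel
  · refine (Commute.one_left z).sub_left ?_
    exact tendsto_nhds_unique (hw.mul_const z)
      ((hw.const_mul z).congr fun n => (commute_sqrtIter hz n).eq.symm)

lemma denseRange_of_injective_adjoint {T : E →L[𝕜] F} (h : Function.Injective (adjoint T)) :
    DenseRange T := by
  have h1 : T.range.topologicalClosure = ⊤ := by
    rw [Submodule.topologicalClosure_eq_top_iff, orthogonal_range]
    exact LinearMap.ker_eq_bot.2 h
  exact Submodule.dense_iff_topologicalClosure_eq_top.2 h1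

/-- The **Douglas lemma** for an injective self-adjoint operator `S`. -/
theorem range_adjoint_le_range_iff {S : E →L[𝕜] E} (hS : IsSelfAdjoint S)
    (hinj : Function.Injective S) (D : E →L[𝕜] F) :
    (adjoint D).range ≤ S.range ↔ ∃ c : ℝ, ∀ x, ‖D x‖ ≤ c * ‖S x‖ := by
  constructor
  · intro h
    let e : E ≃ₗ[𝕜] S.range := LinearEquiv.ofInjective (S : E →ₗ[𝕜] E) hinj
    let f : F →ₗ[𝕜] E := e.symm.toLinearMap ∘ₗ
      ((adjoint D : F →L[𝕜] E) : F →ₗ[𝕜] E).codRestrict S.range (fun k => h ⟨k, rfl⟩)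
    have hf (k : F) : S (f k) = adjoint D k :=
      congrArg Subtype.val (e.apply_symm_apply ⟨adjoint D k, h ⟨k, rfl⟩⟩)
    -- `f = S⁻¹ D*` has closed graph because `S` is injective and continuous.
    let g : F →L[𝕜] E := ⟨f, f.continuous_of_seq_closed_graph fun u x y hu hv => hinj <| by
      rw [hf]
      refine tendsto_nhds_unique ((S.continuous.tendsto _).comp hv) ?_
      have : S ∘ f ∘ u = adjoint D ∘ u := funext fun n => hf (u n)
      rw [this]
      exact ((adjoint D).continuous.tendsto _).comp hu⟩
    have hg : S ∘L g = adjoint D := ContinuousLinearMap.ext hf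
    have hD : D = adjoint g ∘L S := by
      rw [← adjoint_adjoint D, ← hg, adjoint_comp, hS.adjoint_eq]
    refine ⟨‖adjoint g‖, fun x => ?_⟩
    conv_lhs => rw [hD]
    exact (adjoint g).le_opNorm _
  · rintro ⟨c, hc⟩ _ ⟨k, rfl⟩
    -- The bound makes `S x ↦ D x` extend to a bounded `Z`; then `D = Z S` and `D* = S Z*`.
    have hd : DenseRange S := denseRange_of_injective_adjoint (by rwa [hS.adjoint_eq])
    have hZ (x : E) : (D : E →ₗ[𝕜] F).extendOfNorm (S : E →ₗ[𝕜] E) (S x) = D x :=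
      LinearMap.extendOfNorm_eq (f := (D : E →ₗ[𝕜] F)) (e := (S : E →ₗ[𝕜] E)) hd ⟨c, hc⟩ x
    set Z := (D : E →ₗ[𝕜] F).extendOfNorm (S : E →ₗ[𝕜] E)
    have hD : D = Z ∘L S := ContinuousLinearMap.ext fun x => (hZ x).symm
    refine ⟨adjoint Z k, ?_⟩
    rw [hD, adjoint_comp, hS.adjoint_eq]
    rfl

/-- The operators `R`, `S` and `T` of the Halmos theorem, for a self-adjoint idempotent with matrix
`[[X, Q*], [Q, Y]]`. -/
theorem exists_halmos_of_matrix {X : E →L[𝕜] E} {Q : E →L[𝕜] F} {Y : F →L[𝕜] F}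
    (hX : IsSelfAdjoint X) (hX1 : ‖X‖ ≤ 1) (hX2 : ‖1 - X‖ ≤ 1)
    (hXi : Function.Injective X) (hXi' : Function.Injective (1 - X : E →L[𝕜] E))
    (hQi : Function.Injective (adjoint Q))
    (h11 : ∀ x, X (X x) + adjoint Q (Q x) = X x) (h21 : ∀ x, Q (X x) + Y (Q x) = Q x) :
    ∃ (R : E ≃ₗᵢ[𝕜] F) (S T : E →L[𝕜] E), S.IsPositive ∧ ‖S‖ ≤ 1 ∧ Function.Injective S ∧
      Function.Injective (1 - S : E →L[𝕜] E) ∧ IsPosSqrt T (1 - S * S) ∧ X = 1 - S * S ∧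
      (∀ x, Q x = R ((S * T) x)) ∧ (∀ y, adjoint Q y = (S * T) (R.symm y)) ∧
      ∀ y, Y y = R ((S * S) (R.symm y)) := by
  obtain ⟨S, ⟨hSp, hSS⟩, hSc⟩ := exists_isPosSqrt_one_sub hX hX1
  obtain ⟨T, ⟨hTp, hTT⟩, hTc⟩ := exists_isPosSqrt_one_sub ((IsSelfAdjoint.one _).sub hX) hX2
  have hXS : X = 1 - S * S := by rw [hSS]; abel
  have hTT' : T * T = 1 - S * S := by rw [hTT, hSS]
  have hcom : Commute T S := hTc S ((Commute.one_left S).sub_left (hSc X (Commute.refl X)).symm)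
  have hSi : Function.Injective S := by
    refine Function.Injective.of_comp (f := S) ?_
    have : ⇑S ∘ ⇑S = ⇑(1 - X) := by rw [← hSS]; rfl
    rwa [this]
  have hTi : Function.Injective T := by
    refine Function.Injective.of_comp (f := T) ?_
    have : ⇑T ∘ ⇑T = ⇑X := by rw [hXS, ← hTT']; rfl
    rwa [this]
  have hLsa : adjoint (S * T) = S * T := by
    have : star (S * T) = S * T := by
      rw [star_mul, hSp.isSelfAdjoint.star_eq, hTp.isSelfAdjoint.star_eq, hcom.eq]
    exact this
  have hLd : DenseRange (S * T : E →L[𝕜] E) :=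
    denseRange_of_injective_adjoint (by rw [hLsa]; exact hSi.comp hTi)
  have hQd : DenseRange Q := denseRange_of_injective_adjoint hQi
  have hQQ : adjoint Q ∘L Q = (S * T) * (S * T) := by
    have e : (S * T) * (S * T) = (S * S) * (T * T) := by
      rw [mul_assoc, ← mul_assoc T S T, hcom.eq]; simp only [mul_assoc]
    rw [e, hTT', hXS.symm, hSS]
    ext x
    exact (eq_sub_of_add_eq' (h11 x)).trans (by simp)
  have hnorm (x : E) : ‖Q x‖ = ‖(S * T) x‖ := by
    have h1 : ‖Q x‖ ^ 2 = ‖(S * T) x‖ ^ 2 := by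
      rw [apply_norm_sq_eq_inner_adjoint_left, apply_norm_sq_eq_inner_adjoint_left, hQQ, hLsa]
      rfl
    exact (sq_eq_sq₀ (norm_nonneg _) (norm_nonneg _)).1 h1
  let R : E ≃ₗᵢ[𝕜] F := (LinearEquiv.refl 𝕜 E).extendOfIsometry
    ((S * T : E →L[𝕜] E) : E →ₗ[𝕜] E) (Q : E →ₗ[𝕜] F) hLd hQd hnorm
  have hR (x : E) : Q x = R ((S * T) x) :=
    ((LinearEquiv.refl 𝕜 E).extendOfIsometry_eq ((S * T : E →L[𝕜] E) : E →ₗ[𝕜] E)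
      (Q : E →ₗ[𝕜] F) hLd hQd hnorm x).symm
  refine ⟨R, S, T, hSp, ?_, hSi, ?_, ⟨hTp, hTT'⟩, hXS, hR, fun y => ?_, fun y => ?_⟩
  · have h1 : ‖S‖ * ‖S‖ ≤ 1 := by
      rw [← CStarRing.norm_star_mul_self, hSp.isSelfAdjoint.star_eq, hSS]
      exact hX2
    nlinarith [norm_nonneg S]
  · refine Function.Injective.of_comp (f := (1 + S : E →L[𝕜] E)) ?_
    have : ⇑(1 + S) ∘ ⇑(1 - S) = ⇑X := by
      have : X = (1 + S) * (1 - S) := by rw [hXS]; noncomm_ring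
      rw [this]; rfl
    rwa [this]
  · refine ext_inner_right 𝕜 fun x => ?_
    rw [adjoint_inner_left, hR]
    conv_rhs => rw [← hLsa]
    rw [adjoint_inner_left, ← R.inner_map_map, R.apply_symm_apply]
  · obtain ⟨x, rfl⟩ := R.surjective y
    rw [R.symm_apply_apply]
    -- By density it suffices to check vectors `STx`, where `R S T = Q` and `Y Q = Q (1 - X) = Q
    -- S²`.
    refine hLd.induction_on (p := fun x => Y (R x) = R ((S * S) x)) x
      (isClosed_eq (by fun_prop) (by fun_prop)) fun x => ?_
    have h1 : (S * S) ((S * T) x) = (S * T) ((S * S) x) := by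
      have : S * S * (S * T) = S * T * (S * S) := by
        rw [mul_assoc, mul_assoc, ((hcom.mul_right hcom).eq), ← mul_assoc, ← mul_assoc]
        simp only [mul_assoc]
      exact DFunLike.congr_fun this x
    rw [← hR, h1, ← hR, hSS, _root_.sub_apply, one_apply_eq_self, map_sub]
    exact eq_sub_of_add_eq' (h21 x)

end Operators

/-! ### Position of the two subspaces and reduction to the generic part. -/

section Geometry

variable {𝕜 H K : Type*} [RCLike 𝕜]
  [NormedAddCommGroup H] [InnerProductSpace 𝕜 H]
  [NormedAddCommGroup K] [InnerProductSpace 𝕜 K]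

lemma mem_genericPart {M N : Submodule 𝕜 H} {x : H} :
    x ∈ genericPart M N ↔ x ∈ M ∧ (∀ z ∈ M, z ∈ N → inner 𝕜 z x = 0) ∧
      ∀ z ∈ M, z ∈ Nᗮ → inner 𝕜 z x = 0 := by
  rw [genericPart, Submodule.mem_inf, ← Submodule.inf_orthogonal, Submodule.mem_inf,
    Submodule.mem_orthogonal, Submodule.mem_orthogonal]
  simp only [Submodule.mem_inf, and_imp]

lemma genericPart_le (M N : Submodule 𝕜 H) : genericPart M N ≤ M := inf_le_left

lemma genericPart_isOrtho (M N : Submodule 𝕜 H) : genericPart M N ⟂ genericPart Mᗮ N :=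
  (Submodule.isOrtho_orthogonal_right M).mono (genericPart_le M N) (genericPart_le Mᗮ N)

lemma eq_zero_of_mem_genericPart_of_mem {M N : Submodule 𝕜 H} {x : H}
    (hx : x ∈ genericPart M N) (hxN : x ∈ N) : x = 0 :=
  inner_self_eq_zero.1 ((mem_genericPart.1 hx).2.1 x (genericPart_le M N hx) hxN)

lemma eq_zero_of_mem_genericPart_of_mem_orthogonal {M N : Submodule 𝕜 H} {x : H}
    (hx : x ∈ genericPart M N) (hxN : x ∈ Nᗮ) : x = 0 :=
  inner_self_eq_zero.1 ((mem_genericPart.1 hx).2.2 x (genericPart_le M N hx) hxN)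

/-- The adjoint `P_N P_M` fixes `M ∩ N` and kills `M ∩ Nᗮ`. -/
lemma starProjection_starProjection_mem_genericPart {M N : Submodule 𝕜 H}
    [M.HasOrthogonalProjection] [N.HasOrthogonalProjection] {x : H}
    (hx : x ∈ genericPart M N) :
    M.starProjection (N.starProjection x) ∈ genericPart M N := by
  obtain ⟨-, h1, h2⟩ := mem_genericPart.1 hx
  refine mem_genericPart.2 ⟨Submodule.starProjection_apply_mem _ _, fun z hz hzN => ?_,
    fun z hz hzN => ?_⟩
  · rw [← Submodule.inner_starProjection_left_eq_right, Submodule.starProjection_eq_self_iff.2 hz,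
      ← Submodule.inner_starProjection_left_eq_right, Submodule.starProjection_eq_self_iff.2 hzN,
      h1 z hz hzN]
  · rw [← Submodule.inner_starProjection_left_eq_right, Submodule.starProjection_eq_self_iff.2 hz,
      ← Submodule.inner_starProjection_left_eq_right,
      (Submodule.starProjection_apply_eq_zero_iff _).2 hzN, inner_zero_left]

lemma starProjection_orthogonal_starProjection_mem_genericPart {M N : Submodule 𝕜 H}
    [M.HasOrthogonalProjection] [N.HasOrthogonalProjection] {x : H}
    (hx : x ∈ genericPart M N) :
    Mᗮ.starProjection (N.starProjection x) ∈ genericPart Mᗮ N := by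
  refine mem_genericPart.2 ⟨Submodule.starProjection_apply_mem _ _, fun z hz hzN => ?_,
    fun z hz hzN => ?_⟩
  · rw [← Submodule.inner_starProjection_left_eq_right, Submodule.starProjection_eq_self_iff.2 hz,
      ← Submodule.inner_starProjection_left_eq_right, Submodule.starProjection_eq_self_iff.2 hzN]
    exact Submodule.inner_left_of_mem_orthogonal (genericPart_le M N hx) hz
  · rw [← Submodule.inner_starProjection_left_eq_right, Submodule.starProjection_eq_self_iff.2 hz,
      ← Submodule.inner_starProjection_left_eq_right,
      (Submodule.starProjection_apply_eq_zero_iff _).2 hzN, inner_zero_left]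

lemma starProjection_mem_sup_genericPart {M N : Submodule 𝕜 H}
    [M.HasOrthogonalProjection] [N.HasOrthogonalProjection] {x : H}
    (hx : x ∈ genericPart M N) :
    N.starProjection x ∈ genericPart M N ⊔ genericPart Mᗮ N := by
  rw [← Submodule.starProjection_add_starProjection_orthogonal (K := M) (N.starProjection x)]
  exact Submodule.add_mem_sup (starProjection_starProjection_mem_genericPart hx)
    (starProjection_orthogonal_starProjection_mem_genericPart hx)

lemma starProjection_mem_sup_genericPart_of_mem_genericPart_orthogonal {M N : Submodule 𝕜 H}
    [M.HasOrthogonalProjection] [N.HasOrthogonalProjection] {y : H}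
    (hy : y ∈ genericPart Mᗮ N) :
    N.starProjection y ∈ genericPart M N ⊔ genericPart Mᗮ N := by
  have h := starProjection_mem_sup_genericPart hy
  rwa [Submodule.orthogonal_orthogonal, sup_comm] at h

lemma starProjection_add_starProjection_of_mem_sup {U V : Submodule 𝕜 H}
    [U.HasOrthogonalProjection] [V.HasOrthogonalProjection] (hUV : U ⟂ V) {v : H}
    (hv : v ∈ U ⊔ V) : U.starProjection v + V.starProjection v = v := by
  obtain ⟨a, ha, b, hb, rfl⟩ := Submodule.mem_sup.1 hv
  rw [map_add, map_add, Submodule.starProjection_eq_self_iff.2 ha,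
    Submodule.starProjection_eq_self_iff.2 hb,
    (Submodule.starProjection_apply_eq_zero_iff _).2 (hUV.ge hb),
    (Submodule.starProjection_apply_eq_zero_iff _).2 (hUV.le ha), add_zero, zero_add]

instance isClosed_orthogonal_coe (M : Submodule 𝕜 H) : IsClosed (Mᗮ : Set H) :=
  M.isClosed_orthogonal

/-- The `V`-`U` block of the orthogonal projection onto `N`. -/
noncomputable def projBlock (N U V : Submodule 𝕜 H) [N.HasOrthogonalProjection]
    [V.HasOrthogonalProjection] : U →L[𝕜] V :=
  V.orthogonalProjectionOnto ∘L N.starProjection ∘L U.subtypeL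

lemma coe_projBlock_apply (N U V : Submodule 𝕜 H) [N.HasOrthogonalProjection]
    [V.HasOrthogonalProjection] (x : U) :
    (projBlock N U V x : H) = V.starProjection (N.starProjection x) := rfl

lemma norm_projBlock_le (N U V : Submodule 𝕜 H) [N.HasOrthogonalProjection]
    [V.HasOrthogonalProjection] : ‖projBlock N U V‖ ≤ 1 := by
  refine opNorm_le_bound _ zero_le_one fun x => ?_
  rw [one_mul, Submodule.coe_norm, coe_projBlock_apply]
  exact (Submodule.norm_starProjection_apply_le _ _).trans
    (Submodule.norm_starProjection_apply_le _ _)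

lemma one_sub_projBlock_self (N U : Submodule 𝕜 H) [N.HasOrthogonalProjection]
    [U.HasOrthogonalProjection] : 1 - projBlock N U U = projBlock Nᗮ U U := by
  refine ContinuousLinearMap.ext fun x => Subtype.ext ?_
  rw [_root_.sub_apply, one_apply_eq_self, Submodule.coe_sub, coe_projBlock_apply,
    coe_projBlock_apply, Submodule.starProjection_orthogonal_val, map_sub,
    Submodule.starProjection_mem_subspace_eq_self]

/-- For `x ∈ U`, `⟪P_U P_N x, x⟫ = ‖P_N x‖²`. -/
lemma injective_projBlock_self {N U : Submodule 𝕜 H} [N.HasOrthogonalProjection]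
    [U.HasOrthogonalProjection] (h : ∀ x ∈ U, x ∈ Nᗮ → x = 0) :
    Function.Injective (projBlock N U U) := by
  refine (injective_iff_map_eq_zero _).2 fun x hx => Subtype.ext (h x x.2 ?_)
  have h1 : inner 𝕜 (projBlock N U U x) x = 0 := by rw [hx, inner_zero_left]
  rw [Submodule.coe_inner, coe_projBlock_apply, Submodule.inner_starProjection_left_eq_right,
    Submodule.starProjection_mem_subspace_eq_self,
    ← Submodule.starProjection_eq_self_iff.2 (Submodule.starProjection_apply_mem N (x : H)),
    Submodule.inner_starProjection_left_eq_right, inner_self_eq_zero] at h1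
  exact (Submodule.starProjection_apply_eq_zero_iff _).1 h1

lemma mem_domain_simExt {M N : Submodule 𝕜 H} {A B : H →L[𝕜] K}
    {hAB : ∀ x ∈ M ⊓ N, A x = B x} {z : H} :
    z ∈ (simExt M N A B hAB).domain ↔ ∃ m ∈ M, ∃ n ∈ N, m + n = z :=
  Submodule.mem_sup

lemma simExt_apply {M N : Submodule 𝕜 H} {A B : H →L[𝕜] K} {hAB : ∀ x ∈ M ⊓ N, A x = B x}
    {m n : H} (hm : m ∈ M) (hn : n ∈ N) (z : (simExt M N A B hAB).domain) (hz : m + n = z) :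
    simExt M N A B hAB z = A m + B n :=
  LinearPMap.sup_apply _ ⟨m, hm⟩ ⟨n, hn⟩ z hz

lemma isBoundedOp_simExt_iff {M N : Submodule 𝕜 H} [N.HasOrthogonalProjection] {A B : H →L[𝕜] K}
    {hAB : ∀ x ∈ M ⊓ N, A x = B x} :
    IsBoundedOp (simExt M N A B hAB) ↔
      ∃ c : ℝ, ∀ m ∈ M, ‖(A - B) m‖ ≤ c * ‖m - N.starProjection m‖ := by
  constructor
  · rintro ⟨c, hc⟩
    refine ⟨c + ‖B‖, fun m hm => ?_⟩
    have hn : -N.starProjection m ∈ N := neg_mem (Submodule.starProjection_apply_mem N m)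
    have h := hc ⟨m - N.starProjection m,
      mem_domain_simExt.2 ⟨m, hm, _, hn, (sub_eq_add_neg _ _).symm⟩⟩
    rw [simExt_apply hm hn _ (sub_eq_add_neg _ _).symm] at h
    have e : (A - B) m = (A m + B (-N.starProjection m)) - B (m - N.starProjection m) := by
      simp only [_root_.sub_apply, map_sub, map_neg]
      abel
    rw [e, add_mul]
    exact (norm_sub_le _ _).trans (add_le_add h (B.le_opNorm _))
  · rintro ⟨c, hc⟩
    refine ⟨|c| + ‖B‖, fun z => ?_⟩
    obtain ⟨m, hm, n, hn, hz⟩ := mem_domain_simExt.1 z.2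
    have e : A m + B n = (A - B) m + B (m + n) := by
      simp only [_root_.sub_apply, map_add]
      abel
    rw [simExt_apply hm hn z hz, e, hz, add_mul]
    refine (norm_add_le _ _).trans (add_le_add ((hc m hm).trans ?_) (B.le_opNorm _))
    refine mul_le_mul (le_abs_self c) ?_ (norm_nonneg _) (abs_nonneg c)
    have e2 : m - N.starProjection m = Nᗮ.starProjection (z : H) := by
      rw [← hz, Submodule.starProjection_orthogonal_val, map_add,
        Submodule.starProjection_eq_self_iff.2 hn]
      abel
    rw [e2]
    exact Submodule.norm_starProjection_apply_le _ _

variable [CompleteSpace H]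

lemma adjoint_projBlock (N U V : Submodule 𝕜 H) [IsClosed (N : Set H)]
    [IsClosed (U : Set H)] [IsClosed (V : Set H)] :
    adjoint (projBlock N U V) = projBlock N V U := by
  refine ContinuousLinearMap.ext fun y => ext_inner_right 𝕜 fun x => ?_
  rw [adjoint_inner_left, Submodule.coe_inner, Submodule.coe_inner, coe_projBlock_apply,
    coe_projBlock_apply, ← Submodule.inner_starProjection_left_eq_right,
    Submodule.inner_starProjection_left_eq_right U,
    Submodule.starProjection_mem_subspace_eq_self, Submodule.starProjection_mem_subspace_eq_self,
    Submodule.inner_starProjection_left_eq_right]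

/-- The **Halmos two projections theorem**. -/
theorem exists_isHalmosPair (M N : Submodule 𝕜 H) [IsClosed (M : Set H)] [IsClosed (N : Set H)] :
    ∃ (R : genericPart M N ≃ₗᵢ[𝕜] genericPart Mᗮ N)
      (S : genericPart M N →L[𝕜] genericPart M N), IsHalmosPair M N R S := by
  set U := genericPart M N
  set V := genericPart Mᗮ N
  have hUV : U ⟂ V := genericPart_isOrtho M N
  have hPU (x : U) : (projBlock N U U x : H) + projBlock N U V x = N.starProjection x :=
    starProjection_add_starProjection_of_mem_sup hUV (starProjection_mem_sup_genericPart x.2)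
  have hPV (y : V) : (projBlock N V U y : H) + projBlock N V V y = N.starProjection y :=
    starProjection_add_starProjection_of_mem_sup hUV
      (starProjection_mem_sup_genericPart_of_mem_genericPart_orthogonal y.2)
  have hNN (x : H) : N.starProjection (N.starProjection x) = N.starProjection x :=
    Submodule.starProjection_eq_self_iff.2 (Submodule.starProjection_apply_mem N x)
  have hidem (W : Submodule 𝕜 H) [IsClosed (W : Set H)] (x : U) :
      projBlock N U W (projBlock N U U x) + projBlock N V W (projBlock N U V x) =
        projBlock N U W x := by
    refine Subtype.ext ?_
    rw [Submodule.coe_add, coe_projBlock_apply N U W, coe_projBlock_apply N V W, ← map_add,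
      ← map_add, hPU, hNN]
    rfl
  obtain ⟨R, S, T, h1, h2, h3, h4, h5, h6, h7, h8, h9⟩ :=
    exists_halmos_of_matrix (X := projBlock N U U) (Q := projBlock N U V) (Y := projBlock N V V)
      (adjoint_projBlock N U U) (norm_projBlock_le N U U)
      (by rw [one_sub_projBlock_self]; exact norm_projBlock_le _ _ _)
      (injective_projBlock_self fun x hx => eq_zero_of_mem_genericPart_of_mem_orthogonal hx)
      (by
        rw [one_sub_projBlock_self]
        refine injective_projBlock_self fun x hx hx' => ?_
        rw [Submodule.orthogonal_orthogonal] at hx'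
        exact eq_zero_of_mem_genericPart_of_mem hx hx')
      (by
        rw [adjoint_projBlock]
        refine (injective_iff_map_eq_zero _).2 fun y hy => Subtype.ext ?_
        -- With no component in `U`, `P_N y` lies in `V ∩ N = 0`; hence `y ∈ V ∩ Nᗮ = 0`.
        have hy' : N.starProjection (y : H) ∈ V := by
          rw [← hPV, hy]
          simp
        have h0 := eq_zero_of_mem_genericPart_of_mem hy' (Submodule.starProjection_apply_mem N _)
        exact eq_zero_of_mem_genericPart_of_mem_orthogonal y.2
          ((Submodule.starProjection_apply_eq_zero_iff _).1 h0))
      (by rw [adjoint_projBlock]; exact hidem U) (hidem V)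
  refine ⟨R, S, h1, h2, h3, h4, T, h5, fun x y => ?_⟩
  rw [map_add, ← hPU, ← hPV, ← h6, ← h7, ← h8, ← h9, adjoint_projBlock, Submodule.coe_add,
    Submodule.coe_add]
  abel

lemma IsHalmosPair.norm_sub_starProjection {M N : Submodule 𝕜 H} [IsClosed (M : Set H)]
    [IsClosed (N : Set H)] {R : genericPart M N ≃ₗᵢ[𝕜] genericPart Mᗮ N}
    {S : genericPart M N →L[𝕜] genericPart M N} (h : IsHalmosPair M N R S)
    (x : genericPart M N) : ‖(x : H) - N.starProjection x‖ = ‖S x‖ := by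
  obtain ⟨T, -, hT⟩ := h.matrix
  have h1 := hT x 0
  simp only [map_zero, add_zero, Submodule.coe_zero] at h1
  have h2 : inner 𝕜 ((x : H) - N.starProjection x) (x : H) = inner 𝕜 (S x) (S x) := by
    rw [h1, inner_sub_left, inner_add_left,
      (genericPart_isOrtho M N).symm.inner_eq (Submodule.coe_mem _) x.2,
      ← Submodule.coe_inner, ← Submodule.coe_inner, add_zero, ← inner_sub_left]
    have h3 := h.isPositive.inner_left_eq_inner_right (S x) x
    simpa using h3
  have h3 : inner 𝕜 ((x : H) - N.starProjection x) (x : H) =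
      inner 𝕜 ((x : H) - N.starProjection x) ((x : H) - N.starProjection x) := by
    rw [inner_sub_right _ (x : H),
      Submodule.starProjection_inner_eq_zero _ _ (Submodule.starProjection_apply_mem N _), sub_zero]
  rw [h3] at h2
  have h4 := congrArg RCLike.re h2
  rw [inner_self_eq_norm_sq, inner_self_eq_norm_sq] at h4
  exact (sq_eq_sq₀ (norm_nonneg _) (norm_nonneg _)).1 h4

/-- Only the generic part of `M` matters for the boundedness of `C_{M,N}(A,B)`. -/
lemma isBoundedOp_simExt_iff_genericPart {M N : Submodule 𝕜 H} [IsClosed (M : Set H)]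
    [IsClosed (N : Set H)] {A B : H →L[𝕜] K} {hAB : ∀ x ∈ M ⊓ N, A x = B x} :
    IsBoundedOp (simExt M N A B hAB) ↔
      ∃ c : ℝ, ∀ x ∈ genericPart M N, ‖(A - B) x‖ ≤ c * ‖x - N.starProjection x‖ := by
  rw [isBoundedOp_simExt_iff]
  refine ⟨fun ⟨c, hc⟩ => ⟨c, fun x hx => hc x (genericPart_le M N hx)⟩, fun ⟨c, hc⟩ => ?_⟩
  have i1 : IsClosed ((M ⊓ N : Submodule 𝕜 H) : Set H) := IsClosed.inter ‹_› ‹_›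
  have i2 : IsClosed ((M ⊓ Nᗮ : Submodule 𝕜 H) : Set H) :=
    IsClosed.inter ‹_› N.isClosed_orthogonal
  refine ⟨‖A - B‖ + |c|, fun m hm => ?_⟩
  obtain ⟨a, b, x, ha, hb, hx, rfl⟩ : ∃ a b x, a ∈ M ⊓ N ∧ b ∈ M ⊓ Nᗮ ∧ x ∈ genericPart M N ∧
      m = a + b + x := by
    have ha := Submodule.starProjection_apply_mem (M ⊓ N) m
    have hb := Submodule.starProjection_apply_mem (M ⊓ Nᗮ) m
    have ha' := (Submodule.mem_orthogonal _ _).1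
      (Submodule.sub_starProjection_mem_orthogonal (K := M ⊓ N) m)
    have hb' := (Submodule.mem_orthogonal _ _).1
      (Submodule.sub_starProjection_mem_orthogonal (K := M ⊓ Nᗮ) m)
    refine ⟨(M ⊓ N).starProjection m, (M ⊓ Nᗮ).starProjection m,
      m - (M ⊓ N).starProjection m - (M ⊓ Nᗮ).starProjection m, ha, hb,
      mem_genericPart.2 ⟨sub_mem (sub_mem hm ha.1) hb.1, fun z hz hzN => ?_, fun z hz hzN => ?_⟩,
      by abel⟩
    · rw [inner_sub_right, ha' z ⟨hz, hzN⟩, Submodule.inner_right_of_mem_orthogonal hzN hb.2,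
        sub_zero]
    · rw [sub_right_comm, inner_sub_right, hb' z ⟨hz, hzN⟩,
        Submodule.inner_left_of_mem_orthogonal ha.2 hzN, sub_zero]
  have hAB' : (A - B) a = 0 := by rw [_root_.sub_apply, hAB a ha, sub_self]
  have e1 : a + b + x - N.starProjection (a + b + x) = b + (x - N.starProjection x) := by
    rw [map_add, map_add, Submodule.starProjection_eq_self_iff.2 ha.2,
      (Submodule.starProjection_apply_eq_zero_iff _).2 hb.2]
    abel
  -- By Pythagoras, `‖b + (x - P_N x)‖` dominates both summands: `‖A - B‖` handles `b` and `|c|`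
  -- handles `x`.
  have e2 : inner 𝕜 b (x - N.starProjection x) = 0 := by
    rw [inner_sub_right, (mem_genericPart.1 hx).2.2 b hb.1 hb.2,
      Submodule.inner_left_of_mem_orthogonal (Submodule.starProjection_apply_mem N x) hb.2,
      sub_zero]
  have e3 := norm_add_sq_eq_norm_sq_add_norm_sq_of_inner_eq_zero b (x - N.starProjection x) e2
  have hb1 : ‖b‖ ≤ ‖b + (x - N.starProjection x)‖ :=
    abs_le_of_sq_le_sq' (by nlinarith [norm_nonneg (x - N.starProjection x)]) (norm_nonneg _) |>.2
  have hx1 : ‖x - N.starProjection x‖ ≤ ‖b + (x - N.starProjection x)‖ :=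
    abs_le_of_sq_le_sq' (by nlinarith [norm_nonneg b]) (norm_nonneg _) |>.2
  rw [e1, map_add, map_add, hAB', zero_add, add_mul]
  refine (norm_add_le _ _).trans (add_le_add ?_ ?_)
  · exact ((A - B).le_opNorm b).trans (by gcongr)
  · exact (hc x hx).trans (mul_le_mul (le_abs_self c) hx1 (norm_nonneg _) (abs_nonneg c))

end Geometry

end TwoSubspaces

theorem theorem5p6 {𝕜 H K : Type*} [RCLike 𝕜]
    [NormedAddCommGroup H] [InnerProductSpace 𝕜 H] [CompleteSpace H]
    [NormedAddCommGroup K] [InnerProductSpace 𝕜 K] [CompleteSpace K]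
    (M N : Submodule 𝕜 H) [IsClosed (M : Set H)] [IsClosed (N : Set H)]
    (A B : H →L[𝕜] K) (hAB : ∀ x ∈ M ⊓ N, A x = B x) :
    (TwoSubspaces.genericPart M N = ⊥ →
      TwoSubspaces.IsBoundedOp (TwoSubspaces.simExt M N A B hAB)) ∧
    (TwoSubspaces.genericPart M N ≠ ⊥ →
      (∃ (R : TwoSubspaces.genericPart M N ≃ₗᵢ[𝕜] TwoSubspaces.genericPart Mᗮ N)
        (S : TwoSubspaces.genericPart M N →L[𝕜] TwoSubspaces.genericPart M N),
        TwoSubspaces.IsHalmosPair M N R S) ∧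
      ∀ (R : TwoSubspaces.genericPart M N ≃ₗᵢ[𝕜] TwoSubspaces.genericPart Mᗮ N)
        (S : TwoSubspaces.genericPart M N →L[𝕜] TwoSubspaces.genericPart M N),
        TwoSubspaces.IsHalmosPair M N R S →
        (TwoSubspaces.IsBoundedOp (TwoSubspaces.simExt M N A B hAB) ↔
          (ContinuousLinearMap.adjoint (TwoSubspaces.diffRestrict M N A B)).range ≤ S.range)) := by
  refine ⟨fun h => ?_, fun _ => ⟨TwoSubspaces.exists_isHalmosPair M N, fun R S hRS => ?_⟩⟩
  · refine TwoSubspaces.isBoundedOp_simExt_iff_genericPart.2 ⟨0, fun x hx => ?_⟩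
    rw [h, Submodule.mem_bot] at hx
    simp [hx]
  · rw [TwoSubspaces.isBoundedOp_simExt_iff_genericPart,
      TwoSubspaces.range_adjoint_le_range_iff hRS.isPositive.isSelfAdjoint hRS.injective]
    refine exists_congr fun c => ⟨fun h x => ?_, fun h x hx => ?_⟩
    · rw [← hRS.norm_sub_starProjection]
      exact h x x.2
    · have := h ⟨x, hx⟩
      rwa [← hRS.norm_sub_starProjection] at this
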